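/- Let $f:\mathbb{R}\to\mathbb{R}$ be real analytic and let $\mathcal{M}_f=(\mathbb{R}^4,g_f)$, where in the coordinates $(x,y,\tilde x,\tilde y)$ the non-zero components of the pseudo-Riemannian metric $g_f$ of signature $(2,2)$ are, up to symmetry, $$g_f(\partial_x,\partial_x)=-2f(y),\qquad g_f(\partial_x,\partial_{\tilde x})=g_f(\partial_y,\partial_{\tilde y})=1 .$$ Let $\nabla$ be the Levi-Civita connection, $R(X,Y)=\nabla_X\nabla_Y-\nabla_Y\nabla_X-\nabla_{[X,Y]}$, $R(X,Y,Z,W)=g_f(R(X,Y)Z,W)$, and let $\nabla^kR$ ($k\ge0$) be the $k$-th covariant derivative of $R$. Then: 1. For every $k\ge 0$ one has $\nabla^kR(\partial_x,\partial_y,\partial_y,\partial_x;\partial_y,\dots,\partial_y)=f^{(k+2)}(y)$, and, apart from the components obtained from this one by the symmetries $R(X,Y,Z,W)=-R(Y,X,Z,W)=-R(X,Y,W,Z)$ of the curvature tensor, all components of $\nabla^kR$ in the coordinate frame vanish identically. 2. All geodesics of $\mathcal{M}_f$ extend to geodesics defined on all of $\mathbb{R}$. 3. For every $P\in\mathbb{R}^4$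 and every $v\in T_P\mathbb{R}^4$ there is exactly one geodesic $\gamma_v:\mathbb{R}\to\mathbb{R}^4$ with $\gamma_v(0)=P$, $\gamma_v'(0)=v$, and the exponential map $\exp_P:T_P\mathbb{R}^4\to\mathbb{R}^4$, $v\mapsto\gamma_v(1)$, is a diffeomorphism. 4. All local scalar Weyl invariants of $\mathcal{M}_f$ vanish identically; here these are the linear combinations of complete contractions, by means of the metric, of tensor products $\nabla^{k_1}R\otimes\cdots\otimes\nabla^{k_r}R$ with $r\ge1$ and $k_i\ge0$. 5. If $f''$ vanishes nowhere, then $\mathcal{M}_f$ is spacelike and timelike Jordan Osserman: the Jordan normal form of the Jacobi operator $v\mapsto R(v,\xi)\xi$ is the same for all points and all tangent vectors $\xi$ with $g_f(\xi,\xi)=1$, and likewise for all points and all $\xi$ with $g_f(\xi,\xi)=-1$. 6. If $f''$ vanishes nowhere, then $\mathcal{M}_f$ is spacelike and timelike Jordan Ivanov–Petrova: the Jordan normal form of the skew-symmetric curvature operator $v\mapsto R(e_1,e_2)v$, where $(e_1,e_2)$ is an oriented orthonormal basis of an oriented tangent $2$-plane $\pi$, is the same for all points and all spacelike $\pi$ (those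 on which $g_f$ is positive definite), and likewise for all points and all timelike $\pi$ (those on which $g_f$ is negative definite). 7. $\mathcal{M}_f$ is realizable as a hypersurface in $\mathbb{R}^{(2,3)}$: there is a smooth isometric embedding of $\mathcal{M}_f$ into $\mathbb{R}^5$ with the flat metric with two timelike and three spacelike directions. -/

import Mathlib

open Set Topology
open scoped ContDiff Manifold

namespace GenPlaneWave

noncomputable section

/-- The coordinate space `ℝⁿ`; as a manifold it has this one global chart, and every tangent space
is identified with it through the coordinate frame. -/
abbrev Coord (n : ℕ) : Type := Fin n → ℝ

/-- A pseudo-Riemannian metric on `ℝⁿ`, given by its components `g(∂_i, ∂_j)` at each point. -/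
abbrev MetricField (n : ℕ) : Type := Coord n → Matrix (Fin n) (Fin n) ℝ

/-- The components, with respect to the coordinate frame, of a covariant `m`-tensor field:
`T a p = T_p(∂_{a 0}, …, ∂_{a (m-1)})`. -/
abbrev CovTensorField (n m : ℕ) : Type := (Fin m → Fin n) → Coord n → ℝ

/-- The partial derivative `∂_i h` at `p`. -/
def pd {n : ℕ} (i : Fin n) (h : Coord n → ℝ) (p : Coord n) : ℝ :=
  fderiv ℝ h p (Pi.single i 1)

/-- `g_p(u, v)` for tangent vectors `u`, `v` at `p`. -/
def metricAt {n : ℕ} (g : MetricField n) (p u v : Coord n) : ℝ :=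
  ∑ i, ∑ j, g p i j * u i * v j

/-- The Christoffel symbols of the Levi-Civita connection: `∇_{∂_i} ∂_j = ∑ k, Γ^k_{ij} ∂_k`,
with `Γ^k_{ij} = ½ ∑ l, g^{kl} (∂_i g_{jl} + ∂_j g_{il} - ∂_l g_{ij})`. -/
def christoffel {n : ℕ} (g : MetricField n) (k i j : Fin n) (p : Coord n) : ℝ :=
  (1 / 2 : ℝ) * ∑ l, (g p)⁻¹ k l *
    (pd i (fun q => g q j l) p + pd j (fun q => g q i l) p - pd l (fun q => g q i j) p)

/-- The `∂_l`-component of `R(∂_i, ∂_j) ∂_k`, where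
`R(X, Y) = ∇_X ∇_Y - ∇_Y ∇_X - ∇_{[X, Y]}`. -/
def riemannUp {n : ℕ} (g : MetricField n) (i j k l : Fin n) (p : Coord n) : ℝ :=
  pd i (christoffel g l j k) p - pd j (christoffel g l i k) p
    + ∑ m, (christoffel g m j k p * christoffel g l i m p
        - christoffel g m i k p * christoffel g l j m p)

/-- The curvature tensor `R(X, Y, Z, W) = g(R(X, Y) Z, W)`. -/
def riemann {n : ℕ} (g : MetricField n) : CovTensorField n 4 :=
  fun a p => ∑ l, riemannUp g (a 0) (a 1) (a 2) l p * g p l (a 3)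

/-- The covariant derivative of a covariant tensor field; the new (last) slot is the direction of
differentiation: `(∇T)(X_1, …, X_m; Y) = Y T(X_1, …, X_m) - ∑ s, T(X_1, …, ∇_Y X_s, …, X_m)`. -/
def covDeriv {n m : ℕ} (g : MetricField n) (T : CovTensorField n m) : CovTensorField n (m + 1) :=
  fun a p =>
    pd (a (Fin.last m)) (T (Fin.init a)) p
      - ∑ s : Fin m, ∑ k : Fin n,
          christoffel g k (a (Fin.last m)) (Fin.init a s) p
            * T (Function.update (Fin.init a) s k) p

/-- The `k`-th covariant derivative `∇^k R` of the curvature tensor. -/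
def nablaR {n : ℕ} (g : MetricField n) : (k : ℕ) → CovTensorField n (4 + k)
  | 0 => riemann g
  | k + 1 => covDeriv g (nablaR g k)

/-- `γ` is a geodesic on the open set of times `I`. -/
def IsGeodesicOn {n : ℕ} (g : MetricField n) (γ : ℝ → Coord n) (I : Set ℝ) : Prop :=
  ContDiffOn ℝ ∞ γ I ∧
    ∀ t ∈ I, ∀ k, deriv (deriv γ) t k
      + ∑ i, ∑ j, christoffel g k i j (γ t) * deriv γ t i * deriv γ t j = 0

/-- `γ` is a geodesic defined for all time with `γ(0) = P` and `γ'(0) = v`. -/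
def IsGeodesicFrom {n : ℕ} (g : MetricField n) (P v : Coord n) (γ : ℝ → Coord n) : Prop :=
  IsGeodesicOn g γ univ ∧ γ 0 = P ∧ deriv γ 0 = v

/-- Every geodesic on an open interval extends to a geodesic on the whole real line. -/
def GeodesicallyComplete {n : ℕ} (g : MetricField n) : Prop :=
  ∀ (I : Set ℝ) (γ : ℝ → Coord n), IsOpen I → I.OrdConnected → IsGeodesicOn g γ I →
    ∃ γ' : ℝ → Coord n, IsGeodesicOn g γ' univ ∧ EqOn γ' γ I

open Classical in
/-- The exponential map `exp_P : T_P ℝⁿ → ℝⁿ`, `v ↦ γ(1)`, where `γ` is the geodesic with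
`γ(0) = P` and `γ'(0) = v` (the value is `P` if no such geodesic exists for all time). -/
def expMap {n : ℕ} (g : MetricField n) (P v : Coord n) : Coord n :=
  if h : ∃ γ, IsGeodesicFrom g P v γ then h.choose 1 else P

/-- The complete contraction, with respect to the metric, of the tensor
`∇^{k_0} R ⊗ ⋯ ⊗ ∇^{k_{r-1}} R`, whose slots are the pairs `⟨i, s⟩` with `i < r`, `s < 4 + k_i`.
The slots are arranged in `m` disjoint pairs by `e`, and the two slots of each pair are contracted
by means of the inverse metric `g^{ab}`. -/
def completeContraction {n : ℕ} (g : MetricField n) {r m : ℕ} (k : Fin r → ℕ)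
    (e : (Σ i : Fin r, Fin (4 + k i)) ≃ Fin m × Fin 2) (p : Coord n) : ℝ :=
  ∑ a : (Σ i : Fin r, Fin (4 + k i)) → Fin n,
    (∏ j : Fin m, (g p)⁻¹ (a (e.symm (j, 0))) (a (e.symm (j, 1))))
      * ∏ i : Fin r, nablaR g (k i) (fun s => a ⟨i, s⟩) p

/-- The local scalar Weyl invariants: linear combinations of complete contractions of tensor
products of at least one covariant derivative `∇^k R` (`k ≥ 0`) of the curvature tensor. -/
def weylInvariants {n : ℕ} (g : MetricField n) : Submodule ℝ (Coord n → ℝ) :=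
  Submodule.span ℝ
    {h | ∃ (r m : ℕ) (k : Fin r → ℕ) (e : (Σ i : Fin r, Fin (4 + k i)) ≃ Fin m × Fin 2),
      1 ≤ r ∧ h = completeContraction g k e}

/-- The matrix of the Jacobi operator `J(ξ) : v ↦ R(v, ξ) ξ` at `p`. -/
def jacobiOp {n : ℕ} (g : MetricField n) (p ξ : Coord n) : Matrix (Fin n) (Fin n) ℝ :=
  Matrix.of fun l i => ∑ j, ∑ k, riemannUp g i j k l p * ξ j * ξ k

/-- The matrix of the skew-symmetric curvature operator `R(u, v) : w ↦ R(u, v) w` at `p`. -/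
def curvatureOp {n : ℕ} (g : MetricField n) (p u v : Coord n) : Matrix (Fin n) (Fin n) ℝ :=
  Matrix.of fun l k => ∑ i, ∑ j, riemannUp g i j k l p * u i * v j

/-- `J` is in Jordan normal form: block diagonal, each block having a constant diagonal, ones on
the superdiagonal, and zeros elsewhere. -/
def IsJordanMatrix {n : ℕ} (J : Matrix (Fin n) (Fin n) ℂ) : Prop :=
  ∀ i j : Fin n, i ≠ j → J i j ≠ 0 → j.val = i.val + 1 ∧ J i j = 1 ∧ J i i = J j j

/-- `J` is a Jordan normal form of the real square matrix `A`. -/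
def HasJordanForm {n : ℕ} (A : Matrix (Fin n) (Fin n) ℝ) (J : Matrix (Fin n) (Fin n) ℂ) : Prop :=
  IsJordanMatrix J ∧
    ∃ S : GL (Fin n) ℂ, A.map (fun t : ℝ => (t : ℂ))
      = (S : Matrix (Fin n) (Fin n) ℂ) * J * ((S⁻¹ : GL (Fin n) ℂ) : Matrix (Fin n) (Fin n) ℂ)

/-- The Jacobi operator has constant Jordan normal form on the bundle of all tangent vectors `ξ`
with `g(ξ, ξ) = ε` (`ε = 1`: unit spacelike vectors, `ε = -1`: unit timelike vectors). -/
def JordanOsserman {n : ℕ} (ε : ℝ) (g : MetricField n) : Prop :=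
  ∃ J : Matrix (Fin n) (Fin n) ℂ, ∀ p ξ : Coord n, metricAt g p ξ ξ = ε →
    HasJordanForm (jacobiOp g p ξ) J

/-- The skew-symmetric curvature operator `R(π) = R(e₁, e₂)`, where `(e₁, e₂)` is an oriented
orthonormal basis of `π`, has constant Jordan normal form on the bundle of all oriented spacelike
(`ε = 1`) or timelike (`ε = -1`) `2`-planes `π`, that is, of those on which the metric is positive
respectively negative definite. -/
def JordanIvanovPetrova {n : ℕ} (ε : ℝ) (g : MetricField n) : Prop :=
  ∃ J : Matrix (Fin n) (Fin n) ℂ, ∀ p e₁ e₂ : Coord n,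
    metricAt g p e₁ e₁ = ε → metricAt g p e₂ e₂ = ε → metricAt g p e₁ e₂ = 0 →
    HasJordanForm (curvatureOp g p e₁ e₂) J

/-- The inner product of `ℝ^{(p, q)}`, with `p` timelike and `q` spacelike directions. -/
def pseudoInner {p q : ℕ} (u v : Fin p ⊕ Fin q → ℝ) : ℝ :=
  -(∑ i : Fin p, u (Sum.inl i) * v (Sum.inl i)) + ∑ j : Fin q, u (Sum.inr j) * v (Sum.inr j)

/-- There is a smooth isometric embedding of `(ℝⁿ, g)` in `ℝ^{(p, q)}`, as a submanifold of
codimension one. -/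
def RealizableAsHypersurface {n : ℕ} (g : MetricField n) (p q : ℕ) : Prop :=
  p + q = n + 1 ∧
    ∃ Ψ : Coord n → (Fin p ⊕ Fin q → ℝ),
      ContDiff ℝ ∞ Ψ ∧ IsEmbedding Ψ ∧ (∀ x, Function.Injective (fderiv ℝ Ψ x)) ∧
        ∀ x u v, pseudoInner (fderiv ℝ Ψ x u) (fderiv ℝ Ψ x v) = metricAt g x u v

/-- The metric `g_f` on `ℝ⁴`. The coordinates `(x, y, x̃, ỹ)` have the indices `0, 1, 2, 3`; the
nonzero entries are `g_f(∂_x, ∂_x) = -2 f(y)` and `g_f(∂_x, ∂_x̃) = g_f(∂_y, ∂_ỹ) = 1`, up to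
symmetry. -/
def planeWave (f : ℝ → ℝ) : MetricField 4 :=
  fun p => !![-2 * f (p 1), 0, 1, 0;
              0, 0, 0, 1;
              1, 0, 0, 0;
              0, 1, 0, 0]

/-- The multi-index of the component `∇^k R(∂_{b 0}, ∂_{b 1}, ∂_{b 2}, ∂_{b 3}; ∂_y, …, ∂_y)`. -/
def yIndex (k : ℕ) (b : Fin 4 → Fin 4) : Fin (4 + k) → Fin 4 :=
  Fin.append b (fun _ : Fin k => (1 : Fin 4))

end

end GenPlaneWave

open GenPlaneWave

namespace GenPlaneWave

/-! ### Christoffel symbols and curvature -/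

/-! The metric depends on $y$ alone, and $\partial_{\tilde x},\partial_{\tilde y}$ span a parallel
totally isotropic plane $N$. The only Christoffel symbols are $\Gamma^{\tilde x}_{xy}=\Gamma^{\tilde
x}_{yx}=-f'$ and $\Gamma^{\tilde y}_{xx}=f'$: upper indices lie in $\{\tilde x,\tilde y\}$, lower
ones in $\{x,y\}$. Hence the quadratic terms of the curvature vanish, $R$ is $f''$ times a constant
tensor that kills $N$, and in $\nabla^kR$ every connection term feeds a vector of $N$ into such a
tensor. Covariant differentiation is therefore plain $\partial_y$ (`nablaR_planeWave`).

The inverse metric vanishes on pairs of indices from $\{x,y\}$, so every complete contraction is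
zero. The curvature operators map a complement of $N$ into $N$ and kill $N$; a non-null vector, or a
definite plane, projects injectively modulo $N$, which fixes their rank and so their Jordan form.

The geodesic equations are triangular: $x''=y''=0$, $\tilde x''=2f'(y)x'y'$, $\tilde
y''=-f'(y)x'^2$. They are solved for all time by two quadratures, and $\exp_P$ is a translation
followed by a smooth shear along $N$. The hypersurface is the graph of $x^2/2+f(y)$ over flat
$\mathbb R^{(2,2)}$, reparametrized along $N$. -/

lemma pd_comp_coord {n : ℕ} (i c : Fin n) {h : ℝ → ℝ} {p : Coord n}
    (hh : DifferentiableAt ℝ h (p c)) :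
    pd i (fun q => h (q c)) p = if i = c then deriv h (p c) else 0 := by
  have h1 : HasFDerivAt (fun q : Coord n => q c)
      (ContinuousLinearMap.proj (R := ℝ) (φ := fun _ : Fin n => ℝ) c) p :=
    (ContinuousLinearMap.proj (R := ℝ) (φ := fun _ : Fin n => ℝ) c).hasFDerivAt
  have h2 := hh.hasDerivAt.comp_hasFDerivAt p h1
  have h3 : pd i (fun q => h (q c)) p = _ := congrArg (fun L => L (Pi.single i 1)) h2.fderiv
  rw [h3]
  simp [Pi.single_apply, eq_comm]

lemma pd_const_mul_comp_coord {n : ℕ} (i c : Fin n) (a : ℝ) {h : ℝ → ℝ} {p : Coord n}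
    (hh : DifferentiableAt ℝ h (p c)) :
    pd i (fun q => a * h (q c)) p = a * if i = c then deriv h (p c) else 0 := by
  rw [pd_comp_coord i c (h := fun t => a * h t) (hh.const_mul a), deriv_const_mul_field]
  split_ifs <;> simp

lemma pd_const {n : ℕ} (i : Fin n) (a : ℝ) (p : Coord n) : pd i (fun _ => a) p = 0 := by
  simp [pd]

lemma pd_planeWave {f : ℝ → ℝ} (hf : Differentiable ℝ f) (i j l : Fin 4) (p : Coord 4) :
    pd i (fun q => planeWave f q j l) p
      = if i = 1 ∧ j = 0 ∧ l = 0 then -2 * deriv f (p 1) else 0 := by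
  have h0 : pd i (fun q => planeWave f q 0 0) p = -2 * if i = 1 then deriv f (p 1) else 0 :=
    pd_const_mul_comp_coord i 1 (-2) (hf _)
  by_cases h : j = 0 ∧ l = 0
  · obtain ⟨rfl, rfl⟩ := h
    rw [h0]
    split_ifs <;> simp_all
  · rw [if_neg (by tauto)]
    have : ∃ c : ℝ, (fun q : Coord 4 => planeWave f q j l) = fun _ => c := by
      fin_cases j <;> fin_cases l <;> first
        | exact absurd ⟨rfl, rfl⟩ h
        | exact ⟨1, rfl⟩
        | exact ⟨0, rfl⟩
    obtain ⟨c, hc⟩ := this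
    rw [hc, pd_const]

lemma planeWave_inv (f : ℝ → ℝ) (p : Coord 4) :
    (planeWave f p)⁻¹ = !![0, 0, 1, 0; 0, 0, 0, 1; 1, 0, 2 * f (p 1), 0; 0, 1, 0, 0] := by
  apply Matrix.inv_eq_right_inv
  ext i j
  fin_cases i <;> fin_cases j <;>
    simp [planeWave, Matrix.mul_apply, Fin.sum_univ_four]

/-- The coefficient of `f'` in the Christoffel symbol `Γ^k_{ij}` of a plane wave metric. -/
def christoffelCoeff (k i j : Fin 4) : ℤ :=
  if k = 2 ∧ (i = 0 ∧ j = 1 ∨ i = 1 ∧ j = 0) then -1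
  else if k = 3 ∧ i = 0 ∧ j = 0 then 1 else 0

lemma christoffel_planeWave {f : ℝ → ℝ} (hf : Differentiable ℝ f) (k i j : Fin 4)
    (p : Coord 4) :
    christoffel (planeWave f) k i j p = christoffelCoeff k i j * deriv f (p 1) := by
  simp only [christoffel, pd_planeWave hf, planeWave_inv, Fin.sum_univ_four]
  fin_cases k <;> fin_cases i <;> fin_cases j <;> simp [christoffelCoeff]

/-- The coefficient of `f''` in the `∂_l`-component of `R(∂_i, ∂_j) ∂_k`. -/
def riemannUpCoeff (i j k l : Fin 4) : ℤ :=
  (if i = 1 then christoffelCoeff l j k else 0) - if j = 1 then christoffelCoeff l i k else 0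

/-- The summed index $m$ would have to lie in $\{\tilde x,\tilde y\}$ as an upper index and in
$\{x,y\}$ as a lower one. This makes the curvature linear in $f$. -/
lemma christoffelCoeff_mul (l i m j k : Fin 4) :
    christoffelCoeff m j k * christoffelCoeff l i m = 0 := by
  revert l i m j k; decide

lemma riemannUp_planeWave {f : ℝ → ℝ} (hf : ContDiff ℝ ∞ f) (i j k l : Fin 4) (p : Coord 4) :
    riemannUp (planeWave f) i j k l p = riemannUpCoeff i j k l * iteratedDeriv 2 f (p 1) := by
  have hd : Differentiable ℝ f := hf.differentiable (by simp)
  have hd' : Differentiable ℝ (deriv f) :=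
    ((contDiff_infty_iff_deriv.1 hf).2).differentiable (by simp)
  have h2 : iteratedDeriv 2 f = deriv (deriv f) := by
    rw [iteratedDeriv_succ, iteratedDeriv_one]
  have hc : ∀ k i j, christoffel (planeWave f) k i j
      = fun p => (christoffelCoeff k i j : ℝ) * deriv f (p 1) := fun k i j =>
    funext fun p => christoffel_planeWave hd k i j p
  have hz : ∀ l i m j k : Fin 4,
      ((christoffelCoeff m j k : ℝ) * deriv f (p 1)) * (christoffelCoeff l i m * deriv f (p 1))
        = 0 := fun l i m j k => by
    have := congrArg (fun z : ℤ => (z : ℝ)) (christoffelCoeff_mul l i m j k)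
    push_cast at this
    linear_combination (deriv f (p 1)) ^ 2 * this
  simp only [riemannUp, hc, hz, pd_const_mul_comp_coord _ _ _ (hd' _), h2, riemannUpCoeff]
  simp only [sub_self, Finset.sum_const_zero]
  split_ifs <;> push_cast <;> ring

/-- The coefficient of `f''` in the component `R(∂_i, ∂_j, ∂_k, ∂_l)`. -/
def riemannCoeff (i j k l : Fin 4) : ℤ :=
  if l = 0 then riemannUpCoeff i j k 2 else if l = 1 then riemannUpCoeff i j k 3 else 0

lemma riemann_planeWave {f : ℝ → ℝ} (hf : ContDiff ℝ ∞ f) (a : Fin 4 → Fin 4) (p : Coord 4) :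
    riemann (planeWave f) a p
      = riemannCoeff (a 0) (a 1) (a 2) (a 3) * iteratedDeriv 2 f (p 1) := by
  have h0 : ∀ i j k : Fin 4, riemannUpCoeff i j k 0 = 0 := by decide
  have h1 : ∀ i j k : Fin 4, riemannUpCoeff i j k 1 = 0 := by decide
  simp only [riemann, riemannUp_planeWave hf, Fin.sum_univ_four, h0, h1]
  generalize a 3 = l
  fin_cases l <;> simp [riemannCoeff, planeWave]

/-- The coefficient of `f^{(k+2)}` in a component of `∇^k R`. -/
def nablaCoeff : (k : ℕ) → (Fin (4 + k) → Fin 4) → ℤ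
  | 0, a => riemannCoeff (a 0) (a 1) (a 2) (a 3)
  | k + 1, a => if a (Fin.last (4 + k)) = 1 then nablaCoeff k (Fin.init a) else 0

/-- The plane $N$ lies in the kernel of $\nabla^kR$ in every slot: this is read off a finite table
for $R$, and each later slot only admits $\partial_y$. Both the reduction of $\nabla$ to
$\partial_y$ and the vanishing of the Weyl invariants rest on it. -/
lemma nablaCoeff_eq_zero : ∀ (k : ℕ) (a : Fin (4 + k) → Fin 4) (s : Fin (4 + k)),
    a s = 2 ∨ a s = 3 → nablaCoeff k a = 0
  | 0, a, s, hs => by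
    have key : ∀ i j k l : Fin 4, (i = 2 ∨ i = 3) ∨ (j = 2 ∨ j = 3) ∨ (k = 2 ∨ k = 3) ∨
      (l = 2 ∨ l = 3) → riemannCoeff i j k l = 0 := by decide
    refine key _ _ _ _ ?_
    change Fin 4 at s
    fin_cases s <;> tauto
  | k + 1, a, s, hs => by
    rw [nablaCoeff]
    split_ifs with h
    · induction s using Fin.lastCases with
      | last =>
        change a (Fin.last (4 + k)) = 2 ∨ a (Fin.last (4 + k)) = 3 at hs
        rw [h] at hs
        exact absurd hs (by decide)
      | cast s => exact nablaCoeff_eq_zero k _ s hs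
    · rfl

theorem nablaR_planeWave {f : ℝ → ℝ} (hf : ContDiff ℝ ∞ f) : ∀ (k : ℕ) (a : Fin (4 + k) → Fin 4)
    (p : Coord 4), nablaR (planeWave f) k a p = nablaCoeff k a * iteratedDeriv (k + 2) f (p 1)
  | 0, a, p => riemann_planeWave hf a p
  | k + 1, a, p => by
    have hd : Differentiable ℝ f := hf.differentiable (by simp)
    have hk : Differentiable ℝ (iteratedDeriv (k + 2) f) :=
      hf.differentiable_iteratedDeriv (k + 2) (WithTop.coe_lt_coe.2 (ENat.natCast_lt_top _))
    have hT : nablaR (planeWave f) k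
        = fun a p => (nablaCoeff k a : ℝ) * iteratedDeriv (k + 2) f (p 1) :=
      funext fun a => funext fun p => nablaR_planeWave hf k a p
    change pd (a (Fin.last (4 + k))) (nablaR (planeWave f) k (Fin.init a)) p
      - ∑ s : Fin (4 + k), ∑ m : Fin 4,
          christoffel (planeWave f) m (a (Fin.last (4 + k))) (Fin.init a s) p
            * nablaR (planeWave f) k (Function.update (Fin.init a) s m) p = _
    simp only [hT]
    rw [pd_const_mul_comp_coord _ _ _ (hk _), Finset.sum_eq_zero, nablaCoeff,
      show k + 1 + 2 = (k + 2) + 1 by ring, iteratedDeriv_succ (n := k + 2)]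
    · split_ifs <;> simp
    · intro s _
      refine Finset.sum_eq_zero fun m _ => ?_
      rw [christoffel_planeWave hd]
      -- Each connection term vanishes for one of two reasons: the inserted index $m$ is $\tilde x$
      -- or $\tilde y$ and the tensor kills it, or $\Gamma^m$ itself is zero.
      have hm : (m = 2 ∨ m = 3) ∨ ∀ i j, christoffelCoeff m i j = 0 := by
        revert m; decide
      rcases hm with hm | hm
      · rw [nablaCoeff_eq_zero k _ s (by simpa using hm)]
        simp
      · simp [hm]

lemma yIndex_succ (k : ℕ) (b : Fin 4 → Fin 4) :
    yIndex (k + 1) b = Fin.snoc (α := fun _ => Fin 4) (yIndex k b) 1 := by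
  rw [yIndex, yIndex]
  have := Fin.append_snoc b (fun _ : Fin k => (1 : Fin 4)) 1
  rw [← this]
  congr 1
  ext i
  induction i using Fin.lastCases <;> simp

lemma yIndex_zero (b : Fin 4 → Fin 4) : yIndex 0 b = b := by
  rw [yIndex, Fin.append_right_nil _ _ rfl]
  rfl

lemma nablaCoeff_yIndex (b : Fin 4 → Fin 4) :
    ∀ k, nablaCoeff k (yIndex k b) = riemannCoeff (b 0) (b 1) (b 2) (b 3)
  | 0 => by rw [yIndex_zero, nablaCoeff]
  | k + 1 => by
    rw [nablaCoeff, yIndex_succ, Fin.snoc_last, if_pos rfl, Fin.init_snoc, nablaCoeff_yIndex b k]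

/-- The table for $R$ has exactly four nonzero entries, and a nonzero component of $\nabla^{k+1}R$
forces its new slot to be $\partial_y$. -/
lemma eq_yIndex_of_nablaCoeff_ne_zero : ∀ (k : ℕ) (a : Fin (4 + k) → Fin 4), nablaCoeff k a ≠ 0 →
    a = yIndex k ![0, 1, 1, 0] ∨ a = yIndex k ![1, 0, 0, 1] ∨
      a = yIndex k ![1, 0, 1, 0] ∨ a = yIndex k ![0, 1, 0, 1]
  | 0, a, h => by
    have key : ∀ i j k l : Fin 4, riemannCoeff i j k l ≠ 0 →
      (i = 0 ∧ j = 1 ∧ k = 1 ∧ l = 0) ∨ (i = 1 ∧ j = 0 ∧ k = 0 ∧ l = 1) ∨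
      (i = 1 ∧ j = 0 ∧ k = 1 ∧ l = 0) ∨ (i = 0 ∧ j = 1 ∧ k = 0 ∧ l = 1) := by decide
    have ha : a = ![a 0, a 1, a 2, a 3] := by
      ext i; change Fin 4 at i; fin_cases i <;> rfl
    simp only [yIndex_zero]
    rcases key _ _ _ _ h with ⟨h0, h1, h2, h3⟩ | ⟨h0, h1, h2, h3⟩ | ⟨h0, h1, h2, h3⟩ |
      ⟨h0, h1, h2, h3⟩ <;> rw [h0, h1, h2, h3] at ha <;> tauto
  | k + 1, a, h => by
    rw [nablaCoeff] at h
    split_ifs at h with hl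
    · have ha : a = Fin.snoc (α := fun _ => Fin 4) (Fin.init a) 1 := by
        rw [← hl]
        exact (Fin.snoc_init_self (α := fun _ => Fin 4) a).symm
      simp only [yIndex_succ]
      rcases eq_yIndex_of_nablaCoeff_ne_zero k _ h with h | h | h | h <;> rw [h] at ha <;> tauto
    · exact absurd rfl h

/-! ### Weyl invariants -/

lemma completeContraction_planeWave {f : ℝ → ℝ} (hf : ContDiff ℝ ∞ f) {r m : ℕ} (k : Fin r → ℕ)
    (e : (Σ i : Fin r, Fin (4 + k i)) ≃ Fin m × Fin 2) (hr : 1 ≤ r) (p : Coord 4) :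
    completeContraction (planeWave f) k e p = 0 := by
  refine Finset.sum_eq_zero fun a _ => ?_
  by_cases h : ∃ s, a s = 2 ∨ a s = 3
  · obtain ⟨⟨i, s⟩, hs⟩ := h
    refine mul_eq_zero_of_right _ (Finset.prod_eq_zero (Finset.mem_univ i) ?_)
    rw [nablaR_planeWave hf, nablaCoeff_eq_zero _ _ s hs]
    simp
  · push Not at h
    -- Now all indices are $x$ or $y$, so any single contracted pair meets the zero block of
    -- $g^{-1}$. The condition $r\ge1$ supplies a slot, hence a pair.
    let j : Fin m := (e ⟨⟨0, hr⟩, ⟨0, by omega⟩⟩).1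
    refine mul_eq_zero_of_left (Finset.prod_eq_zero (Finset.mem_univ j) ?_) _
    rw [planeWave_inv]
    have hu := h (e.symm (j, 0))
    have hv := h (e.symm (j, 1))
    revert hu hv
    generalize a (e.symm (j, 0)) = u
    generalize a (e.symm (j, 1)) = v
    rintro ⟨hu1, hu2⟩ ⟨hv1, hv2⟩
    fin_cases u <;> fin_cases v <;> simp_all

theorem weylInvariants_planeWave {f : ℝ → ℝ} (hf : ContDiff ℝ ∞ f) (h : Coord 4 → ℝ)
    (hh : h ∈ weylInvariants (planeWave f)) (p : Coord 4) : h p = 0 := by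
  induction hh using Submodule.span_induction with
  | mem x hx =>
    obtain ⟨r, m, k, e, hr, rfl⟩ := hx
    exact completeContraction_planeWave hf k e hr p
  | zero => rfl
  | add x y _ _ hx hy => simp [hx, hy]
  | smul c x _ hx => simp [hx]

/-! ### Jordan normal forms -/

lemma metricAt_planeWave (f : ℝ → ℝ) (p u v : Coord 4) :
    metricAt (planeWave f) p u v
      = -2 * f (p 1) * u 0 * v 0 + u 0 * v 2 + u 2 * v 0 + u 1 * v 3 + u 3 * v 1 := by
  simp [metricAt, planeWave, Fin.sum_univ_four]
  ring

/-- A real Jordan basis, the columns of $S$, suffices: complexifying $AS=SJ$ preserves both the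
relation and invertibility, and no inverse need be computed. -/
lemma hasJordanForm_of_mul_eq {n : ℕ} {A S : Matrix (Fin n) (Fin n) ℝ}
    {J : Matrix (Fin n) (Fin n) ℝ} (hJ : IsJordanMatrix (J.map (fun t : ℝ => (t : ℂ))))
    (hS : S.det ≠ 0) (h : A * S = S * J) :
    HasJordanForm A (J.map (fun t : ℝ => (t : ℂ))) := by
  refine ⟨hJ, ?_⟩
  let φ := Complex.ofRealHom
  have hdet : IsUnit (S.map φ).det := by
    rw [← RingHom.mapMatrix_apply, ← RingHom.map_det]
    exact (Ne.isUnit hS).map φ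
  let U : GL (Fin n) ℂ := Matrix.GeneralLinearGroup.mk'' (S.map φ) hdet
  refine ⟨U, ?_⟩
  have hU : (U : Matrix (Fin n) (Fin n) ℂ) = S.map φ := rfl
  change A.map φ = U * J.map φ * _
  rw [Units.eq_mul_inv_iff_mul_eq, hU, ← Matrix.map_mul, ← Matrix.map_mul, h]

/-- The Jordan normal form of a nilpotent `4 × 4` matrix with square zero and rank one. -/
def jordanRankOne : Matrix (Fin 4) (Fin 4) ℝ :=
  !![0, 1, 0, 0; 0, 0, 0, 0; 0, 0, 0, 0; 0, 0, 0, 0]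

/-- The Jordan normal form of a nilpotent `4 × 4` matrix with square zero and rank two. -/
def jordanRankTwo : Matrix (Fin 4) (Fin 4) ℝ :=
  !![0, 1, 0, 0; 0, 0, 0, 0; 0, 0, 0, 1; 0, 0, 0, 0]

lemma isJordanMatrix_jordanRankOne :
    IsJordanMatrix (jordanRankOne.map (fun t : ℝ => (t : ℂ))) := by
  intro i j
  fin_cases i <;> fin_cases j <;> simp [jordanRankOne]

lemma isJordanMatrix_jordanRankTwo :
    IsJordanMatrix (jordanRankTwo.map (fun t : ℝ => (t : ℂ))) := by
  intro i j
  fin_cases i <;> fin_cases j <;> simp [jordanRankTwo]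

lemma jacobiOp_planeWave {f : ℝ → ℝ} (hf : ContDiff ℝ ∞ f) (p ξ : Coord 4) :
    jacobiOp (planeWave f) p ξ = iteratedDeriv 2 f (p 1) •
      !![0, 0, 0, 0; 0, 0, 0, 0; ξ 1 * ξ 1, -(ξ 0 * ξ 1), 0, 0;
        -(ξ 0 * ξ 1), ξ 0 * ξ 0, 0, 0] := by
  ext l i
  simp only [jacobiOp, Matrix.of_apply, riemannUp_planeWave hf, Fin.sum_univ_four]
  fin_cases l <;> fin_cases i <;>
    simp [riemannUpCoeff, christoffelCoeff] <;> ring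

lemma curvatureOp_planeWave {f : ℝ → ℝ} (hf : ContDiff ℝ ∞ f) (p u v : Coord 4) :
    curvatureOp (planeWave f) p u v = ((u 0 * v 1 - u 1 * v 0) * iteratedDeriv 2 f (p 1)) •
      !![0, 0, 0, 0; 0, 0, 0, 0; 0, 1, 0, 0; -1, 0, 0, 0] := by
  ext l i
  simp only [curvatureOp, Matrix.of_apply, riemannUp_planeWave hf, Fin.sum_univ_four]
  fin_cases l <;> fin_cases i <;>
    simp [riemannUpCoeff, christoffelCoeff] <;> ring

lemma jordanOsserman_planeWave {f : ℝ → ℝ} (hf : ContDiff ℝ ∞ f)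
    (h2 : ∀ y, iteratedDeriv 2 f y ≠ 0) {ε : ℝ} (hε : ε ≠ 0) :
    JordanOsserman ε (planeWave f) := by
  refine ⟨_, fun p ξ hξ => hasJordanForm_of_mul_eq isJordanMatrix_jordanRankOne
    -- With $w=(\xi_1,-\xi_0,0,0)$ the columns are $J(\xi)w$, $w$, and the kernel vectors
    -- $(\xi_0,\xi_1,0,0)$ and $(0,0,\xi_0,\xi_1)$. The determinant is $f''(\xi_0^2+\xi_1^2)^3$ up
    -- to sign, nonzero because a non-null $\xi$ lies outside the isotropic plane $N$.
    (S := !![0, ξ 1, ξ 0, 0; 0, -ξ 0, ξ 1, 0;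
      iteratedDeriv 2 f (p 1) * (ξ 0 ^ 2 + ξ 1 ^ 2) * ξ 1, 0, 0, ξ 0;
      -(iteratedDeriv 2 f (p 1) * (ξ 0 ^ 2 + ξ 1 ^ 2) * ξ 0), 0, 0, ξ 1]) ?_ ?_⟩
  · have hne : ξ 0 ^ 2 + ξ 1 ^ 2 ≠ 0 := by
      intro h
      have h0 : ξ 0 = 0 := by nlinarith [sq_nonneg (ξ 0), sq_nonneg (ξ 1)]
      have h1 : ξ 1 = 0 := by nlinarith [sq_nonneg (ξ 0), sq_nonneg (ξ 1)]
      rw [metricAt_planeWave, h0, h1] at hξ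
      exact hε (by rw [← hξ]; ring)
    have hne' := mul_ne_zero (h2 (p 1)) (pow_ne_zero 3 hne)
    intro h
    simp [Matrix.det_succ_row_zero, Fin.sum_univ_succ, Fin.succAbove] at h
    exact hne' (by linear_combination h)
  · rw [jacobiOp_planeWave hf]
    ext i j
    fin_cases i <;> fin_cases j <;>
      simp [jordanRankOne, Matrix.mul_apply, Fin.sum_univ_four] <;> ring

lemma jordanIvanovPetrova_planeWave {f : ℝ → ℝ} (hf : ContDiff ℝ ∞ f)
    (h2 : ∀ y, iteratedDeriv 2 f y ≠ 0) {ε : ℝ} (hε : ε ≠ 0) :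
    JordanIvanovPetrova ε (planeWave f) := by
  refine ⟨jordanRankTwo.map (fun t : ℝ => (t : ℂ)), fun p u v huu hvv huv => ?_⟩
  rw [metricAt_planeWave] at huu hvv huv
  have hD : u 0 * v 1 - u 1 * v 0 ≠ 0 := by
    intro hD
    -- The left side is $g(w,w)$ for $w=v_0u-u_0v$, whose $x$-component is $0$ and whose
    -- $y$-component is minus the determinant in `hD`. So $w\in N$ is null. The next step does the
    -- same with $v_1u-u_1v$.
    have h0 : ε * (u 0 ^ 2 + v 0 ^ 2) = 0 := by
      linear_combination (-v 0 ^ 2) * huu - u 0 ^ 2 * hvv + 2 * u 0 * v 0 * huv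
        + 2 * (u 0 * v 3 - v 0 * u 3) * hD
    have h1 : ε * (u 1 ^ 2 + v 1 ^ 2) = 0 := by
      linear_combination (-v 1 ^ 2) * huu - u 1 ^ 2 * hvv + 2 * u 1 * v 1 * huv
        + (2 * (v 1 * u 2 - u 1 * v 2) - 2 * f (p 1) * (u 0 * v 1 - u 1 * v 0)) * hD
    have h0' := (mul_eq_zero.1 h0).resolve_left hε
    have h1' := (mul_eq_zero.1 h1).resolve_left hε
    have hu0 : u 0 = 0 := by nlinarith [sq_nonneg (u 0), sq_nonneg (v 0)]
    have hu1 : u 1 = 0 := by nlinarith [sq_nonneg (u 1), sq_nonneg (v 1)]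
    rw [hu0, hu1] at huu
    exact hε (by rw [← huu]; ring)
  have hc := mul_ne_zero hD (h2 (p 1))
  rw [curvatureOp_planeWave hf]
  generalize (u 0 * v 1 - u 1 * v 0) * iteratedDeriv 2 f (p 1) = c at hc
  refine hasJordanForm_of_mul_eq isJordanMatrix_jordanRankTwo
    -- The columns are $A\partial_x,\ \partial_x,\ A\partial_y,\ \partial_y$ for the curvature
    -- operator $A$.
    (S := !![0, 1, 0, 0; 0, 0, 0, 1; 0, 0, c, 0; -c, 0, 0, 0]) ?_ ?_
  · simp [Matrix.det_succ_row_zero, Fin.sum_univ_succ, Fin.succAbove, hc]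
  · ext i j
    fin_cases i <;> fin_cases j <;>
      simp [jordanRankTwo, Matrix.mul_apply, Fin.sum_univ_four]

/-! ### Realization as a hypersurface -/

/-- The embedding of a plane wave in `ℝ^{(2, 3)}`; `B` is a primitive of `(f')²`. -/
noncomputable def hypersurfaceMap (f B : ℝ → ℝ) (q : Coord 4) : Fin 2 ⊕ Fin 3 → ℝ :=
  Sum.elim
    ![q 0 - (q 2 - q 0 * f (q 1) - q 0 ^ 3 / 6) / 2, q 1 - (q 3 - B (q 1) / 2) / 2]
    ![q 0 + (q 2 - q 0 * f (q 1) - q 0 ^ 3 / 6) / 2, q 1 + (q 3 - B (q 1) / 2) / 2,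
      q 0 ^ 2 / 2 + f (q 1)]

/-- The differential of `hypersurfaceMap`. -/
noncomputable def hypersurfaceDeriv (f B : ℝ → ℝ) (q u : Coord 4) : Fin 2 ⊕ Fin 3 → ℝ :=
  Sum.elim
    ![u 0 - (u 2 - (u 0 * f (q 1) + q 0 * (deriv f (q 1) * u 1)) - q 0 ^ 2 * u 0 / 2) / 2,
      u 1 - (u 3 - deriv B (q 1) * u 1 / 2) / 2]
    ![u 0 + (u 2 - (u 0 * f (q 1) + q 0 * (deriv f (q 1) * u 1)) - q 0 ^ 2 * u 0 / 2) / 2,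
      u 1 + (u 3 - deriv B (q 1) * u 1 / 2) / 2,
      q 0 * u 0 + deriv f (q 1) * u 1]

lemma contDiff_hypersurfaceMap {f B : ℝ → ℝ} (hf : ContDiff ℝ ∞ f) (hB : ContDiff ℝ ∞ B) :
    ContDiff ℝ ∞ (hypersurfaceMap f B) := by
  rw [contDiff_pi]
  rintro (i | i) <;> fin_cases i <;> simp [hypersurfaceMap] <;> fun_prop

lemma fderiv_hypersurfaceMap {f B : ℝ → ℝ} (hf : ContDiff ℝ ∞ f) (hB : ContDiff ℝ ∞ B)
    (q u : Coord 4) :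
    fderiv ℝ (hypersurfaceMap f B) q u = hypersurfaceDeriv f B q u := by
  have hΨ := (contDiff_hypersurfaceMap hf hB).differentiable (by simp) q
  have hline : HasDerivAt (fun t : ℝ => q + t • u) u 0 := by
    simpa using ((hasDerivAt_id (0 : ℝ)).smul_const u).const_add q
  have hcomp : HasDerivAt (fun t : ℝ => hypersurfaceMap f B (q + t • u))
      (fderiv ℝ (hypersurfaceMap f B) q u) 0 := by
    have h0 : q + (0 : ℝ) • u = q := by simp
    exact HasFDerivAt.comp_hasDerivAt (0 : ℝ) (by simpa only [h0] using hΨ.hasFDerivAt) hline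
  have hc : ∀ i, HasDerivAt (fun t : ℝ => q i + t * u i) (u i) 0 := fun i => by
    simpa using ((hasDerivAt_id (0 : ℝ)).mul_const (u i)).const_add (q i)
  have hfc : ∀ {h : ℝ → ℝ}, ContDiff ℝ ∞ h →
      HasDerivAt (fun t : ℝ => h (q 1 + t * u 1)) (deriv h (q 1) * u 1) 0 := fun {h} hh =>
    (hh.differentiable (by simp) (q 1)).hasDerivAt.comp_of_eq (0 : ℝ) (hc 1) (by simp)
  have hA : HasDerivAt (fun t : ℝ => (q 2 + t * u 2) - (q 0 + t * u 0) * f (q 1 + t * u 1)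
      - (q 0 + t * u 0) ^ 3 / 6)
      (u 2 - (u 0 * f (q 1) + q 0 * (deriv f (q 1) * u 1)) - q 0 ^ 2 * u 0 / 2) 0 := by
    refine (((hc 2).sub ((hc 0).mul (hfc hf))).sub (((hc 0).pow 3).div_const 6)).congr_deriv ?_
    simp
    ring
  have hBB : HasDerivAt (fun t : ℝ => (q 3 + t * u 3) - B (q 1 + t * u 1) / 2)
      (u 3 - deriv B (q 1) * u 1 / 2) 0 := (hc 3).sub ((hfc hB).div_const 2)
  refine hcomp.unique (hasDerivAt_pi.2 ?_)
  rintro (i | i) <;> fin_cases i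
  · exact (hc 0).sub (hA.div_const 2)
  · exact (hc 1).sub (hBB.div_const 2)
  · exact (hc 0).add (hA.div_const 2)
  · exact (hc 1).add (hBB.div_const 2)
  · refine ((((hc 0).pow 2).div_const 2).add (hfc hf)).congr_deriv ?_
    simp [hypersurfaceDeriv]
    ring

/-- The first four components are null coordinates, giving $2\,dx\,dA+2\,dy\,dC+dh^2$ with $A=\tilde
x-xf-x^3/6$, $C=\tilde y-B/2$, $h=x^2/2+f$. The correction $-xf$ in $A$ produces $-2f\,dx^2$ and
cancels the cross term of $dh^2$; $-x^3/6$ cancels $x^2dx^2$, and $-B/2$ cancels $f'^2dy^2$. -/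
lemma pseudoInner_hypersurfaceDeriv {f B : ℝ → ℝ} (hB : ∀ y, deriv B y = deriv f y ^ 2)
    (q u v : Coord 4) :
    pseudoInner (hypersurfaceDeriv f B q u) (hypersurfaceDeriv f B q v)
      = metricAt (planeWave f) q u v := by
  simp [pseudoInner, hypersurfaceDeriv, metricAt_planeWave, Fin.sum_univ_succ, hB]
  ring

lemma isEmbedding_hypersurfaceMap {f B : ℝ → ℝ} (hf : ContDiff ℝ ∞ f) (hB : ContDiff ℝ ∞ B) :
    IsEmbedding (hypersurfaceMap f B) := by
  have hfc := hf.continuous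
  have hBc := hB.continuous
  let X : (Fin 2 ⊕ Fin 3 → ℝ) → ℝ := fun w => (w (.inl 0) + w (.inr 0)) / 2
  let Y : (Fin 2 ⊕ Fin 3 → ℝ) → ℝ := fun w => (w (.inl 1) + w (.inr 1)) / 2
  have hX : Continuous X := by fun_prop
  have hY : Continuous Y := by fun_prop
  let inv : (Fin 2 ⊕ Fin 3 → ℝ) → Coord 4 := fun w =>
    ![X w, Y w, w (.inr 0) - w (.inl 0) + X w * f (Y w) + X w ^ 3 / 6,
      w (.inr 1) - w (.inl 1) + B (Y w) / 2]
  -- Sums of null pairs recover $x$ and $y$, and differences then recover $\tilde x$ and $\tilde y$.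
  refine Function.LeftInverse.isEmbedding (f := inv) ?_ ?_
    (contDiff_hypersurfaceMap hf hB).continuous
  · intro q
    have hx : X (hypersurfaceMap f B q) = q 0 := by simp [X, hypersurfaceMap]
    have hy : Y (hypersurfaceMap f B q) = q 1 := by simp [Y, hypersurfaceMap]
    ext i
    fin_cases i
    · exact hx
    · exact hy
    · simp only [inv, hx, hy]
      simp [hypersurfaceMap]
      ring
    · simp only [inv, hx, hy]
      simp [hypersurfaceMap]
  · refine continuous_pi fun i => ?_
    fin_cases i <;> simp [inv] <;> fun_prop

lemma metricAt_planeWave_nondegenerate {f : ℝ → ℝ} {p u : Coord 4}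
    (h : ∀ v, metricAt (planeWave f) p u v = 0) : u = 0 := by
  simp only [metricAt_planeWave] at h
  have h0 : u 0 = 0 := by simpa using h (Pi.single 2 1)
  have h1 : u 1 = 0 := by simpa using h (Pi.single 3 1)
  have h2 : u 2 = 0 := by simpa [h0] using h (Pi.single 0 1)
  have h3 : u 3 = 0 := by simpa using h (Pi.single 1 1)
  ext i
  fin_cases i <;> assumption

theorem realizableAsHypersurface_planeWave {f : ℝ → ℝ} (hf : ContDiff ℝ ∞ f) :
    RealizableAsHypersurface (planeWave f) 2 3 := by
  have hf' : ContDiff ℝ ∞ (deriv f) := (contDiff_infty_iff_deriv.1 hf).2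
  let B : ℝ → ℝ := fun y => ∫ t in (0 : ℝ)..y, deriv f t ^ 2
  have hBd : ∀ y, HasDerivAt B (deriv f y ^ 2) y := fun y =>
    ((hf'.continuous.pow 2).integral_hasStrictDerivAt 0 y).hasDerivAt
  have hB : ContDiff ℝ ∞ B := by
    rw [contDiff_infty_iff_deriv]
    refine ⟨fun y => (hBd y).differentiableAt, ?_⟩
    rw [show deriv B = fun y => deriv f y ^ 2 from funext fun y => (hBd y).deriv]
    exact hf'.pow 2
  have hiso : ∀ x u v, pseudoInner (fderiv ℝ (hypersurfaceMap f B) x u)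
      (fderiv ℝ (hypersurfaceMap f B) x v) = metricAt (planeWave f) x u v := fun x u v => by
    rw [fderiv_hypersurfaceMap hf hB, fderiv_hypersurfaceMap hf hB]
    exact pseudoInner_hypersurfaceDeriv (fun y => (hBd y).deriv) x u v
  refine ⟨rfl, hypersurfaceMap f B, contDiff_hypersurfaceMap hf hB,
    isEmbedding_hypersurfaceMap hf hB, fun x => ?_, hiso⟩
  rw [injective_iff_map_eq_zero]
  intro u hu
  -- A kernel vector of the differential is $g$-orthogonal to everything, since the pulled-back form
  -- is $g$.
  refine metricAt_planeWave_nondegenerate (f := f) (p := x) fun v => ?_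
  rw [← hiso, hu]
  simp [pseudoInner]

/-! ### Geodesics -/

lemma sum_christoffel_planeWave {f : ℝ → ℝ} (hf : Differentiable ℝ f) (p u : Coord 4)
    (k : Fin 4) :
    ∑ i, ∑ j, christoffel (planeWave f) k i j p * u i * u j
      = ![0, 0, -(2 * deriv f (p 1) * u 0 * u 1), deriv f (p 1) * u 0 ^ 2] k := by
  simp only [christoffel_planeWave hf, Fin.sum_univ_four]
  fin_cases k <;> simp [christoffelCoeff] <;> ring

/-- The solution of `W'' = h`, `W t₀ = W' t₀ = 0`. -/
noncomputable def doublePrimitive (t₀ : ℝ) (h : ℝ → ℝ) (t : ℝ) : ℝ :=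
  t * (∫ r in t₀..t, h r) - ∫ r in t₀..t, r * h r

/-- The function is $\int_{t_0}^t(t-r)h(r)\,dr$; the two boundary terms $t\,h(t)$ cancel. -/
lemma hasDerivAt_doublePrimitive (t₀ : ℝ) {h : ℝ → ℝ} (hh : Continuous h) (t : ℝ) :
    HasDerivAt (doublePrimitive t₀ h) (∫ r in t₀..t, h r) t := by
  have h1 := (hh.integral_hasStrictDerivAt t₀ t).hasDerivAt
  have h2 := ((continuous_id.mul hh).integral_hasStrictDerivAt t₀ t).hasDerivAt
  refine (((hasDerivAt_id t).mul h1).sub h2).congr_deriv ?_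
  simp

lemma contDiff_integral {t₀ : ℝ} {h : ℝ → ℝ} (hh : ContDiff ℝ ∞ h) :
    ContDiff ℝ ∞ (fun t => ∫ r in t₀..t, h r) := by
  have hd : ∀ t, HasDerivAt (fun t => ∫ r in t₀..t, h r) (h t) t := fun t =>
    (hh.continuous.integral_hasStrictDerivAt t₀ t).hasDerivAt
  rw [contDiff_infty_iff_deriv]
  refine ⟨fun t => (hd t).differentiableAt, ?_⟩
  rwa [show deriv (fun t => ∫ r in t₀..t, h r) = h from funext fun t => (hd t).deriv]

lemma contDiff_doublePrimitive {t₀ : ℝ} {h : ℝ → ℝ} (hh : ContDiff ℝ ∞ h) :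
    ContDiff ℝ ∞ (doublePrimitive t₀ h) :=
  (contDiff_id.mul (contDiff_integral hh)).sub (contDiff_integral (contDiff_id.mul hh))

/-- `f'` along the `y`-coordinate of a geodesic. -/
noncomputable def derivAlong (f : ℝ → ℝ) (t₀ a b : ℝ) (r : ℝ) : ℝ := deriv f (a + (r - t₀) * b)

/-- The geodesic of a plane wave with position `P` and velocity `v` at time `t₀`. -/
noncomputable def geodesicCurve (f : ℝ → ℝ) (t₀ : ℝ) (P v : Coord 4) (t : ℝ) : Coord 4 :=
  ![P 0 + (t - t₀) * v 0, P 1 + (t - t₀) * v 1,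
    P 2 + (t - t₀) * v 2 + 2 * v 0 * v 1 * doublePrimitive t₀ (derivAlong f t₀ (P 1) (v 1)) t,
    P 3 + (t - t₀) * v 3 - v 0 ^ 2 * doublePrimitive t₀ (derivAlong f t₀ (P 1) (v 1)) t]

/-- The velocity of `geodesicCurve`. -/
noncomputable def geodesicVelocity (f : ℝ → ℝ) (t₀ : ℝ) (P v : Coord 4) (t : ℝ) : Coord 4 :=
  ![v 0, v 1, v 2 + 2 * v 0 * v 1 * ∫ r in t₀..t, derivAlong f t₀ (P 1) (v 1) r,
    v 3 - v 0 ^ 2 * ∫ r in t₀..t, derivAlong f t₀ (P 1) (v 1) r]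

lemma contDiff_derivAlong {f : ℝ → ℝ} (hf : ContDiff ℝ ∞ f) (t₀ a b : ℝ) :
    ContDiff ℝ ∞ (derivAlong f t₀ a b) := by
  have hf' : ContDiff ℝ ∞ (deriv f) := (contDiff_infty_iff_deriv.1 hf).2
  unfold derivAlong
  fun_prop

lemma contDiff_geodesicCurve {f : ℝ → ℝ} (hf : ContDiff ℝ ∞ f) (t₀ : ℝ) (P v : Coord 4) :
    ContDiff ℝ ∞ (geodesicCurve f t₀ P v) := by
  have hW := contDiff_doublePrimitive (t₀ := t₀) (contDiff_derivAlong hf t₀ (P 1) (v 1))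
  rw [contDiff_pi]
  intro i
  fin_cases i <;> simp [geodesicCurve] <;> fun_prop

lemma hasDerivAt_geodesicCurve {f : ℝ → ℝ} (hf : ContDiff ℝ ∞ f) (t₀ : ℝ) (P v : Coord 4)
    (t : ℝ) : HasDerivAt (geodesicCurve f t₀ P v) (geodesicVelocity f t₀ P v t) t := by
  have hW := hasDerivAt_doublePrimitive t₀ (contDiff_derivAlong hf t₀ (P 1) (v 1)).continuous t
  have hl : ∀ i, HasDerivAt (fun t => P i + (t - t₀) * v i) (v i) t := fun i => by
    simpa using (((hasDerivAt_id t).sub_const t₀).mul_const (v i)).const_add (P i)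
  rw [hasDerivAt_pi]
  intro i
  fin_cases i
  · exact hl 0
  · exact hl 1
  · exact (hl 2).add (hW.const_mul _)
  · exact (hl 3).sub (hW.const_mul _)

lemma hasDerivAt_geodesicVelocity {f : ℝ → ℝ} (hf : ContDiff ℝ ∞ f) (t₀ : ℝ) (P v : Coord 4)
    (t : ℝ) : HasDerivAt (geodesicVelocity f t₀ P v)
      ![0, 0, 2 * v 0 * v 1 * derivAlong f t₀ (P 1) (v 1) t,
        -(v 0 ^ 2 * derivAlong f t₀ (P 1) (v 1) t)] t := by
  have hV := ((contDiff_derivAlong hf t₀ (P 1) (v 1)).continuous.integral_hasStrictDerivAt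
    t₀ t).hasDerivAt
  rw [hasDerivAt_pi]
  intro i
  fin_cases i
  · exact hasDerivAt_const t (v 0)
  · exact hasDerivAt_const t (v 1)
  · exact (hV.const_mul _).const_add _
  · exact (hV.const_mul _).const_sub _

lemma isGeodesicOn_geodesicCurve {f : ℝ → ℝ} (hf : ContDiff ℝ ∞ f) (t₀ : ℝ) (P v : Coord 4) :
    IsGeodesicOn (planeWave f) (geodesicCurve f t₀ P v) univ := by
  refine ⟨(contDiff_geodesicCurve hf t₀ P v).contDiffOn, fun t _ k => ?_⟩
  have h1 : deriv (geodesicCurve f t₀ P v) = geodesicVelocity f t₀ P v :=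
    funext fun t => (hasDerivAt_geodesicCurve hf t₀ P v t).deriv
  rw [h1, (hasDerivAt_geodesicVelocity hf t₀ P v t).deriv,
    sum_christoffel_planeWave (hf.differentiable (by simp))]
  fin_cases k <;> simp [geodesicCurve, geodesicVelocity, derivAlong] <;> ring

lemma geodesicCurve_self (f : ℝ → ℝ) (t₀ : ℝ) (P v : Coord 4) :
    geodesicCurve f t₀ P v t₀ = P := by
  ext i
  fin_cases i <;> simp [geodesicCurve, doublePrimitive]

lemma deriv_geodesicCurve_self {f : ℝ → ℝ} (hf : ContDiff ℝ ∞ f) (t₀ : ℝ) (P v : Coord 4) :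
    deriv (geodesicCurve f t₀ P v) t₀ = v := by
  rw [(hasDerivAt_geodesicCurve hf t₀ P v t₀).deriv]
  ext i
  fin_cases i <;> simp [geodesicVelocity]

/-- Two integrations on an interval. Agreement of the velocities is recorded too, because the
equations for $\tilde x,\tilde y$ involve $x'$ and $y'$. -/
lemma eqOn_of_second_deriv_eq {I : Set ℝ} (hI : IsOpen I) (hc : IsPreconnected I) {t₀ : ℝ}
    (ht₀ : t₀ ∈ I) {u u' u'' w w' w'' : ℝ → ℝ}
    (hu : ∀ t ∈ I, HasDerivAt u (u' t) t) (hu' : ∀ t ∈ I, HasDerivAt u' (u'' t) t)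
    (hw : ∀ t ∈ I, HasDerivAt w (w' t) t) (hw' : ∀ t ∈ I, HasDerivAt w' (w'' t) t)
    (h2 : ∀ t ∈ I, u'' t = w'' t) (h0 : u t₀ = w t₀) (h1 : u' t₀ = w' t₀) :
    EqOn u w I ∧ EqOn u' w' I := by
  have key : ∀ {a a' b b' : ℝ → ℝ}, (∀ t ∈ I, HasDerivAt a (a' t) t) →
      (∀ t ∈ I, HasDerivAt b (b' t) t) → EqOn a' b' I → a t₀ = b t₀ → EqOn a b I :=
    fun ha hb hab h => hI.eqOn_of_deriv_eq hc
      (fun t ht => (ha t ht).differentiableAt.differentiableWithinAt)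
      (fun t ht => (hb t ht).differentiableAt.differentiableWithinAt)
      (fun t ht => by rw [(ha t ht).deriv, (hb t ht).deriv, hab ht]) ht₀ h
  have h' := key hu' hw' h2 h1
  exact ⟨key hu hw h' h0, h'⟩

lemma IsGeodesicOn.hasDerivAt {n : ℕ} {g : MetricField n} {γ : ℝ → Coord n} {I : Set ℝ}
    (h : IsGeodesicOn g γ I) (hI : IsOpen I) (i : Fin n) {t : ℝ} (ht : t ∈ I) :
    HasDerivAt (fun t => γ t i) (deriv γ t i) t ∧
      HasDerivAt (fun t => deriv γ t i) (deriv (deriv γ) t i) t := by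
  have h1 := (h.1.differentiableOn (by simp)).differentiableAt (hI.mem_nhds ht)
  have h2 := ((contDiffOn_infty_iff_deriv_of_isOpen hI).1 h.1).2.differentiableOn
    (by simp) |>.differentiableAt (hI.mem_nhds ht)
  exact ⟨hasDerivAt_pi.1 h1.hasDerivAt i, hasDerivAt_pi.1 h2.hasDerivAt i⟩

/-- The triangular form replaces a general ODE uniqueness theorem: $x,y$ agree first, and then the
second derivatives of $\tilde x,\tilde y$ are the same known functions. -/
theorem IsGeodesicOn.eqOn_planeWave {f : ℝ → ℝ} (hf : ContDiff ℝ ∞ f) {γ δ : ℝ → Coord 4}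
    {I : Set ℝ} (hI : IsOpen I) (hc : I.OrdConnected) (hγ : IsGeodesicOn (planeWave f) γ I)
    (hδ : IsGeodesicOn (planeWave f) δ I) {t₀ : ℝ} (ht₀ : t₀ ∈ I) (h0 : γ t₀ = δ t₀)
    (h1 : deriv γ t₀ = deriv δ t₀) : EqOn γ δ I := by
  have hd : Differentiable ℝ f := hf.differentiable (by simp)
  have key : ∀ i, (∀ t ∈ I, deriv (deriv γ) t i = deriv (deriv δ) t i) →
      EqOn (fun t => γ t i) (fun t => δ t i) I ∧
        EqOn (fun t => deriv γ t i) (fun t => deriv δ t i) I := fun i h2 =>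
    eqOn_of_second_deriv_eq hI hc.isPreconnected ht₀
      (fun t ht => (hγ.hasDerivAt hI i ht).1) (fun t ht => (hγ.hasDerivAt hI i ht).2)
      (fun t ht => (hδ.hasDerivAt hI i ht).1) (fun t ht => (hδ.hasDerivAt hI i ht).2)
      h2 (congrFun h0 i) (congrFun h1 i)
  have eqγ := hγ.2
  have eqδ := hδ.2
  simp only [sum_christoffel_planeWave hd] at eqγ eqδ
  have k0 := key 0 fun t ht => by
    have a := eqγ t ht 0
    have b := eqδ t ht 0
    simp at a b
    rw [a, b]
  have k1 := key 1 fun t ht => by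
    have a := eqγ t ht 1
    have b := eqδ t ht 1
    simp at a b
    rw [a, b]
  have k2 := key 2 fun t ht => by
    have a := eqγ t ht 2
    have b := eqδ t ht 2
    have y := k1.1 ht
    have x' := k0.2 ht
    have y' := k1.2 ht
    simp at a b y x' y'
    rw [y, x', y'] at a
    linarith
  have k3 := key 3 fun t ht => by
    have a := eqγ t ht 3
    have b := eqδ t ht 3
    have y := k1.1 ht
    have x' := k0.2 ht
    simp at a b y x'
    rw [y, x'] at a
    linarith
  intro t ht
  ext i
  fin_cases i
  · exact k0.1 ht
  · exact k1.1 ht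
  · exact k2.1 ht
  · exact k3.1 ht

theorem geodesicallyComplete_planeWave {f : ℝ → ℝ} (hf : ContDiff ℝ ∞ f) :
    GeodesicallyComplete (planeWave f) := by
  intro I γ hI hc hγ
  rcases I.eq_empty_or_nonempty with rfl | ⟨t₀, ht₀⟩
  · exact ⟨_, isGeodesicOn_geodesicCurve hf 0 0 0, eqOn_empty _ _⟩
  · have hδ := isGeodesicOn_geodesicCurve hf t₀ (γ t₀) (deriv γ t₀)
    refine ⟨_, hδ, IsGeodesicOn.eqOn_planeWave hf hI hc
      ⟨hδ.1.mono (subset_univ I), fun t _ => hδ.2 t (mem_univ t)⟩ hγ ht₀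
      (geodesicCurve_self _ _ _ _) (deriv_geodesicCurve_self hf _ _ _)⟩

lemma isGeodesicFrom_geodesicCurve {f : ℝ → ℝ} (hf : ContDiff ℝ ∞ f) (P v : Coord 4) :
    IsGeodesicFrom (planeWave f) P v (geodesicCurve f 0 P v) :=
  ⟨isGeodesicOn_geodesicCurve hf 0 P v, geodesicCurve_self f 0 P v,
    deriv_geodesicCurve_self hf 0 P v⟩

lemma IsGeodesicFrom.eq_geodesicCurve {f : ℝ → ℝ} (hf : ContDiff ℝ ∞ f) {P v : Coord 4}
    {γ : ℝ → Coord 4} (hγ : IsGeodesicFrom (planeWave f) P v γ) : γ = geodesicCurve f 0 P v := by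
  have h := isGeodesicFrom_geodesicCurve hf P v
  exact eqOn_univ _ _ |>.1 <| IsGeodesicOn.eqOn_planeWave hf isOpen_univ ordConnected_univ hγ.1
    h.1 (mem_univ 0) (hγ.2.1.trans h.2.1.symm) (hγ.2.2.trans h.2.2.symm)

theorem existsUnique_isGeodesicFrom_planeWave {f : ℝ → ℝ} (hf : ContDiff ℝ ∞ f)
    (P v : Coord 4) : ∃! γ : ℝ → Coord 4, IsGeodesicFrom (planeWave f) P v γ :=
  ⟨_, isGeodesicFrom_geodesicCurve hf P v, fun _ hγ => hγ.eq_geodesicCurve hf⟩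

lemma expMap_planeWave {f : ℝ → ℝ} (hf : ContDiff ℝ ∞ f) (P v : Coord 4) :
    expMap (planeWave f) P v = geodesicCurve f 0 P v 1 := by
  have h : ∃ γ, IsGeodesicFrom (planeWave f) P v γ := ⟨_, isGeodesicFrom_geodesicCurve hf P v⟩
  rw [expMap, dif_pos h]
  exact congrFun (h.choose_spec.eq_geodesicCurve hf) 1

/-! ### The exponential map -/

lemma hasDerivAt_integral_mul_comp_affine (a : ℝ) {w g : ℝ → ℝ} (hw : Continuous w)
    (hg : ContDiff ℝ ∞ g) (b₀ : ℝ) :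
    HasDerivAt (fun b => ∫ r in (0 : ℝ)..1, w r * g (a + r * b))
      (∫ r in (0 : ℝ)..1, w r * r * deriv g (a + r * b₀)) b₀ := by
  have hgc := hg.continuous
  have hg' : Continuous (deriv g) := (contDiff_infty_iff_deriv.1 hg).2.continuous
  have hcont : Continuous (fun x : ℝ × ℝ => w x.2 * x.2 * deriv g (a + x.2 * x.1)) := by
    fun_prop
  obtain ⟨C, hC⟩ := ((isCompact_closedBall b₀ 1).prod (isCompact_Icc (a := (0 : ℝ))
    (b := 1))).exists_bound_of_continuousOn hcont.continuousOn
  refine (intervalIntegral.hasDerivAt_integral_of_dominated_loc_of_deriv_le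
    (F := fun b r => w r * g (a + r * b)) (F' := fun b r => w r * r * deriv g (a + r * b))
    (bound := fun _ => C) (Metric.closedBall_mem_nhds b₀ one_pos) ?_ ?_ ?_ ?_ ?_ ?_).2
  · exact Filter.Eventually.of_forall fun b =>
      (show Continuous fun r => w r * g (a + r * b) by fun_prop).aestronglyMeasurable
  · exact (show Continuous fun r => w r * g (a + r * b₀) by fun_prop).intervalIntegrable _ _
  · exact (show Continuous fun r => w r * r * deriv g (a + r * b₀) by
      fun_prop).aestronglyMeasurable
  · refine Filter.Eventually.of_forall fun r hr b hb => hC (b, r) ⟨hb, ?_⟩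
    rw [uIoc_of_le zero_le_one] at hr
    exact ⟨hr.1.le, hr.2⟩
  · exact intervalIntegrable_const
  · refine Filter.Eventually.of_forall fun r _ b _ => ?_
    have hl : HasDerivAt (fun b => a + r * b) r b := by
      simpa using ((hasDerivAt_id b).const_mul r).const_add a
    refine (((hg.differentiable (by simp) _).hasDerivAt.comp b hl).const_mul (w r)).congr_deriv ?_
    ring

/-- Differentiating under the integral replaces $(w,g)$ by $(rw,g')$; keeping the weight $w$ general
makes the family closed under differentiation, so the induction runs. -/
lemma contDiff_integral_mul_comp_affine (a : ℝ) {w g : ℝ → ℝ} (hw : Continuous w)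
    (hg : ContDiff ℝ ∞ g) :
    ContDiff ℝ ∞ (fun b => ∫ r in (0 : ℝ)..1, w r * g (a + r * b)) := by
  rw [contDiff_infty]
  intro n
  induction n generalizing w g with
  | zero =>
    exact contDiff_zero.2 (continuous_iff_continuousAt.2 fun b =>
      (hasDerivAt_integral_mul_comp_affine a hw hg b).continuousAt)
  | succ n ih =>
    have hd := hasDerivAt_integral_mul_comp_affine a hw hg
    push_cast
    refine contDiff_succ_iff_deriv.2 ⟨fun b => (hd b).differentiableAt, by simp, ?_⟩
    rw [funext fun b => (hd b).deriv]
    exact ih (w := fun r => w r * r) (by fun_prop) (contDiff_infty_iff_deriv.1 hg).2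

/-- The value at time one of `W'' = f'(a + t b)`, `W 0 = W' 0 = 0`. -/
noncomputable def expShift (f : ℝ → ℝ) (a b : ℝ) : ℝ := doublePrimitive 0 (derivAlong f 0 a b) 1

lemma contDiff_expShift {f : ℝ → ℝ} (hf : ContDiff ℝ ∞ f) (a : ℝ) :
    ContDiff ℝ ∞ (expShift f a) := by
  have hf' : ContDiff ℝ ∞ (deriv f) := (contDiff_infty_iff_deriv.1 hf).2
  have h1 := contDiff_integral_mul_comp_affine a (w := fun _ => 1) continuous_const hf'
  have h2 := contDiff_integral_mul_comp_affine a (w := fun r => r) continuous_id hf'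
  have h : expShift f a = fun b => (∫ r in (0 : ℝ)..1, 1 * deriv f (a + r * b))
      - ∫ r in (0 : ℝ)..1, r * deriv f (a + r * b) := by
    ext b
    simp [expShift, doublePrimitive, derivAlong]
  rw [h]
  exact h1.sub h2

/-- The exponential map of a plane wave as a diffeomorphism. -/
noncomputable def expDiffeomorph {f : ℝ → ℝ} (hf : ContDiff ℝ ∞ f) (P : Coord 4) :
    Diffeomorph 𝓘(ℝ, Coord 4) 𝓘(ℝ, Coord 4) (Coord 4) (Coord 4) ∞ where
  toFun v := ![P 0 + v 0, P 1 + v 1, P 2 + v 2 + 2 * v 0 * v 1 * expShift f (P 1) (v 1),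
    P 3 + v 3 - v 0 ^ 2 * expShift f (P 1) (v 1)]
  invFun q := ![q 0 - P 0, q 1 - P 1,
    q 2 - P 2 - 2 * (q 0 - P 0) * (q 1 - P 1) * expShift f (P 1) (q 1 - P 1),
    q 3 - P 3 + (q 0 - P 0) ^ 2 * expShift f (P 1) (q 1 - P 1)]
  -- The shear term depends only on $v_0,v_1$, which are read off directly from the $x,y$
  -- components, so it can be subtracted exactly.
  left_inv v := by
    ext i
    fin_cases i <;> simp <;> ring
  right_inv q := by
    ext i
    fin_cases i <;> simp <;> ring
  contMDiff_toFun := by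
    have hK := contDiff_expShift hf (P 1)
    refine ContDiff.contMDiff (contDiff_pi.2 fun i => ?_)
    fin_cases i <;> simp <;> fun_prop
  contMDiff_invFun := by
    have hK := contDiff_expShift hf (P 1)
    refine ContDiff.contMDiff (contDiff_pi.2 fun i => ?_)
    fin_cases i <;> simp <;> fun_prop

lemma expDiffeomorph_apply {f : ℝ → ℝ} (hf : ContDiff ℝ ∞ f) (P v : Coord 4) :
    expDiffeomorph hf P v = expMap (planeWave f) P v := by
  rw [expMap_planeWave hf]
  change ![_, _, _, _] = _
  simp [geodesicCurve, expShift]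

end GenPlaneWave

theorem theorem1p3 (f : ℝ → ℝ) (hf : AnalyticOnNhd ℝ f univ) :
    -- the components of the covariant derivatives of the curvature tensor
    (∀ (k : ℕ) (p : Coord 4),
      nablaR (planeWave f) k (yIndex k ![0, 1, 1, 0]) p = iteratedDeriv (k + 2) f (p 1) ∧
      nablaR (planeWave f) k (yIndex k ![1, 0, 0, 1]) p = iteratedDeriv (k + 2) f (p 1) ∧
      nablaR (planeWave f) k (yIndex k ![1, 0, 1, 0]) p = -iteratedDeriv (k + 2) f (p 1) ∧
      nablaR (planeWave f) k (yIndex k ![0, 1, 0, 1]) p = -iteratedDeriv (k + 2) f (p 1) ∧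
      ∀ a : Fin (4 + k) → Fin 4,
        a ≠ yIndex k ![0, 1, 1, 0] → a ≠ yIndex k ![1, 0, 0, 1] →
        a ≠ yIndex k ![1, 0, 1, 0] → a ≠ yIndex k ![0, 1, 0, 1] →
        nablaR (planeWave f) k a p = 0) ∧
    -- completeness
    GeodesicallyComplete (planeWave f) ∧
    -- the exponential maps are well defined on the whole tangent space and are diffeomorphisms
    (∀ P : Coord 4,
      (∀ v : Coord 4, ∃! γ : ℝ → Coord 4, IsGeodesicFrom (planeWave f) P v γ) ∧
      ∃ Φ : Diffeomorph 𝓘(ℝ, Coord 4) 𝓘(ℝ, Coord 4) (Coord 4) (Coord 4) ∞,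
        ∀ v, Φ v = expMap (planeWave f) P v) ∧
    -- the local scalar Weyl invariants
    (∀ h ∈ weylInvariants (planeWave f), ∀ p, h p = 0) ∧
    -- spacelike and timelike Jordan Osserman and Jordan Ivanov-Petrova
    ((∀ y, iteratedDeriv 2 f y ≠ 0) →
      JordanOsserman 1 (planeWave f) ∧ JordanOsserman (-1) (planeWave f) ∧
      JordanIvanovPetrova 1 (planeWave f) ∧ JordanIvanovPetrova (-1) (planeWave f)) ∧
    -- realization as a hypersurface
    RealizableAsHypersurface (planeWave f) 2 3 := by
  have hs : ContDiff ℝ ∞ f := hf.contDiff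
  refine ⟨fun k p => ?_, geodesicallyComplete_planeWave hs, fun P =>
    ⟨existsUnique_isGeodesicFrom_planeWave hs P,
      expDiffeomorph hs P, expDiffeomorph_apply hs P⟩,
    weylInvariants_planeWave hs, fun h2 =>
    ⟨jordanOsserman_planeWave hs h2 one_ne_zero,
      jordanOsserman_planeWave hs h2 (neg_ne_zero.2 one_ne_zero),
      jordanIvanovPetrova_planeWave hs h2 one_ne_zero,
      jordanIvanovPetrova_planeWave hs h2 (neg_ne_zero.2 one_ne_zero)⟩,
    realizableAsHypersurface_planeWave hs⟩
  simp only [nablaR_planeWave hs, nablaCoeff_yIndex]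
  refine ⟨?_, ?_, ?_, ?_, fun a h1 h2 h3 h4 => ?_⟩
  · simp [riemannCoeff, riemannUpCoeff, christoffelCoeff]
  · simp [riemannCoeff, riemannUpCoeff, christoffelCoeff]
  · simp [riemannCoeff, riemannUpCoeff, christoffelCoeff]
  · simp [riemannCoeff, riemannUpCoeff, christoffelCoeff]
  · have h0 : nablaCoeff k a = 0 := by
      by_contra h
      have := eq_yIndex_of_nablaCoeff_ne_zero k a h
      tauto
    simp [h0]
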